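/- Let $k\ge 2$. The random $k$-tree process is the sequence of random graphs $G(0),G(1),\dots$ in which $G(0)$ is a clique on $k$ vertices and, for $t\ge 1$, $G(t)$ is obtained from $G(t-1)$ by choosing a $k$-clique of $G(t-1)$ uniformly at random and adding a new vertex joined to all vertices of the chosen $k$-clique; thus $G(n)$ has $n+k$ vertices. For a graph $G$, let $$\alpha(G)=\min\Big\{\frac{|\partial S|}{|S|} : S\subseteq V(G),\ 0<|S|\le \frac{|V(G)|}{2}\Big\},\qquad \Phi(G)=\min\Big\{\frac{e(S,V(G)\setminus S)}{\mathrm{vol}(S)} : S\subseteq V(G),\ 0<\mathrm{vol}(S)\le \frac{\mathrm{vol}(V(G))}{2}\Big\}$$ be its vertex expansion and its conductance, where $\partial S$ is the set of vertices in $V(G)\setminus S$ that have a neighbor in $S$, $e(S,V(G)\setminus S)$ is the number of edges between $S$ and $V(G)\setminus S$, and $\mathrm{vol}(S)=\sum_{u\in S}\deg(u)$. **Proposition.** There is an absolute constant $C>0$ such that the following holds for every integer $k\ge 2$. 1. Deterministically, i.e. for every $n\ge 1$ and every possible outcome of $G(n)$, $\alpha(G(n))\le C\,k/n$. 2. With high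 probability $\Phi(G(n))\le C\,\log n\cdot n^{-1/k}$; that is, for each fixed $k$, the probability of this event tends to $1$ as $n\to\infty$. -/

import Mathlib

open Filter Topology

namespace RandomKTree

section Expansion

variable {V : Type*} [Fintype V]

open Classical in
/-- The outer vertex boundary `∂S`: the vertices outside `S` that have a neighbor in `S`. -/
noncomputable def vertexBoundary (G : SimpleGraph V) (S : Finset V) : Finset V :=
  Finset.univ.filter fun v => v ∉ S ∧ ∃ u ∈ S, G.Adj u v

/-- The vertex expansion `α(G)`: the minimum of `|∂S| / |S|` over `0 < |S| ≤ |V| / 2`.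
The infimum is over a finite set, which is nonempty as soon as `G` has two vertices,
so that it is a minimum. -/
noncomputable def vertexExpansion (G : SimpleGraph V) : ℝ :=
  sInf {r : ℝ | ∃ S : Finset V, 0 < S.card ∧ 2 * S.card ≤ Fintype.card V ∧
    r = ((vertexBoundary G S).card : ℝ) / (S.card : ℝ)}

open Classical in
/-- The volume of `S`: the sum of the degrees of its vertices. -/
noncomputable def vol (G : SimpleGraph V) (S : Finset V) : ℕ :=
  ∑ u ∈ S, G.degree u

open Classical in
/-- The number `e(S, V \ S)` of edges between `S` and its complement. -/
noncomputable def edgeBoundaryCard (G : SimpleGraph V) (S : Finset V) : ℕ :=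
  (G.interedges S Sᶜ).card

/-- The conductance `Φ(G)`: the minimum of `e(S, V \ S) / vol(S)` over
`0 < vol(S) ≤ vol(V) / 2`. The infimum is over a finite set, which is nonempty as soon as `G`
has an edge, so that it is a minimum. -/
noncomputable def conductance (G : SimpleGraph V) : ℝ :=
  sInf {r : ℝ | ∃ S : Finset V, 0 < vol G S ∧ 2 * vol G S ≤ vol G Finset.univ ∧
    r = (edgeBoundaryCard G S : ℝ) / (vol G S : ℝ)}

end Expansion

/-- Add to a graph on `{0, …, m - 1}` a new vertex `m`, joined exactly to the vertices in `s`. -/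
def addVertex {m : ℕ} (G : SimpleGraph (Fin m)) (s : Finset (Fin m)) :
    SimpleGraph (Fin (m + 1)) where
  Adj u v :=
    (∃ a b, G.Adj a b ∧ u = a.castSucc ∧ v = b.castSucc) ∨
    (u = Fin.last m ∧ ∃ a ∈ s, v = a.castSucc) ∨
    (v = Fin.last m ∧ ∃ a ∈ s, u = a.castSucc)
  symm := ⟨by
    rintro u v (⟨a, b, h, hu, hv⟩ | h | h)
    · exact Or.inl ⟨b, a, h.symm, hv, hu⟩
    · exact Or.inr (Or.inr h)
    · exact Or.inr (Or.inl h)⟩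
  loopless := ⟨by
    rintro u (⟨a, b, h, hu, hv⟩ | ⟨h, a, -, ha⟩ | ⟨h, a, -, ha⟩)
    · have hab : a = b := Fin.castSucc_injective m (hu.symm.trans hv)
      exact G.loopless.irrefl a (hab ▸ h)
    · exact (Fin.castSucc_lt_last a).ne (ha.symm.trans h)
    · exact (Fin.castSucc_lt_last a).ne (ha.symm.trans h)⟩

theorem isNClique_addVertex {m k : ℕ} {G : SimpleGraph (Fin m)} (s : Finset (Fin m))
    {t : Finset (Fin m)} (ht : G.IsNClique k t) :
    (addVertex G s).IsNClique k (t.map Fin.castSuccEmb) := by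
  refine ⟨?_, by rw [Finset.card_map]; exact ht.card_eq⟩
  intro u hu v hv huv
  simp only [Finset.coe_map, Set.mem_image, Finset.mem_coe] at hu hv
  obtain ⟨a, ha, rfl⟩ := hu
  obtain ⟨b, hb, rfl⟩ := hv
  exact Or.inl ⟨a, b, ht.isClique ha hb (fun h => huv (by rw [h])), rfl, rfl⟩

/-- The graphs on `m` labelled vertices that contain at least one `k`-clique. -/
abbrev CliqueGraph (k m : ℕ) : Type :=
  {G : SimpleGraph (Fin m) // ∃ s : Finset (Fin m), G.IsNClique k s}

open Classical in
/-- The set of all `k`-cliques (as vertex sets). -/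
noncomputable def kCliques {m : ℕ} (k : ℕ) (G : SimpleGraph (Fin m)) :
    Finset (Finset (Fin m)) :=
  Finset.univ.filter fun s => G.IsNClique k s

theorem kCliques_nonempty {k m : ℕ} (G : CliqueGraph k m) : (kCliques k G.1).Nonempty := by
  obtain ⟨s, hs⟩ := G.2
  exact ⟨s, by simpa [kCliques] using hs⟩

/-- One round: choose a `k`-clique of the current graph uniformly at random and join a new vertex
to all of its vertices. -/
noncomputable def step {k m : ℕ} (G : CliqueGraph k m) : PMF (CliqueGraph k (m + 1)) :=
  (PMF.uniformOfFinset (kCliques k G.1) (kCliques_nonempty G)).map fun s =>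
    ⟨addVertex G.1 s, G.2.elim fun _ ht => ⟨_, isNClique_addVertex s ht⟩⟩

/-- The law of the process after `n` rounds. It starts with a clique on `k` vertices; the vertex
born in round `t ≥ 1` is labelled `k + t - 1`. -/
noncomputable def processLaw (k : ℕ) : (n : ℕ) → PMF (CliqueGraph k (k + n))
  | 0 => PMF.pure ⟨⊤, Finset.univ, by simp [SimpleGraph.isNClique_iff, SimpleGraph.IsClique,
      Set.Pairwise]⟩
  | n + 1 => (processLaw k n).bind step

/-- The law of the random `k`-tree `G(n)` on `n + k` vertices. -/
noncomputable def randomKTree (k n : ℕ) : PMF (SimpleGraph (Fin (k + n))) :=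
  (processLaw k n).map Subtype.val

end RandomKTree

/-! Every outcome has a balanced set with small boundary. In birth order the earlier neighbors of
each vertex form a clique of size at most `k`, so the vertices reachable from `v` along increasing
labels have boundary inside the earlier neighbors of `v`. As in finding a centroid, take the last
`v` whose descendant set exceeds half the graph and combine descendant sets of later vertices. This
gives `S` with between a quarter and half of the vertices and at most `k + 1` boundary vertices
(`IsElimination.exists_balanced`), hence the bound on vertex expansion.

For conductance, the same `S` is crossed by at most `k + 1` times the maximum degree many edges,
while `S` and its complement both have volume at least a quarter of the number of vertices. It
remains to bound the maximum degree by about `n ^ (1 - 1 / k)` up to a logarithm. A vertex of degree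
`d` lies in at most `(k - 1) * d` of the `k * n + 1` cliques, so the expected third rising factorial
moment of the degrees obeys a linear recurrence and is `O(n ^ (3 * (1 - 1 / k)))`. Markov's
inequality finishes. -/

namespace RandomKTree

/-! ### Expansion and conductance from a balanced set -/

section Expansion

variable {V : Type*} [Fintype V]

open Classical in
/-- The degree of a vertex, as the cardinality of a filtered set. -/
noncomputable def deg (G : SimpleGraph V) (u : V) : ℕ :=
  (Finset.univ.filter fun v => G.Adj u v).card

theorem vol_eq_sum_deg (G : SimpleGraph V) (S : Finset V) : vol G S = ∑ u ∈ S, deg G u := by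
  classical
  unfold vol deg
  refine Finset.sum_congr rfl fun u _ => ?_
  rw [← SimpleGraph.card_neighborFinset_eq_degree]
  congr 1
  ext v
  simp

theorem mem_vertexBoundary {G : SimpleGraph V} {S : Finset V} {v : V} :
    v ∈ vertexBoundary G S ↔ v ∉ S ∧ ∃ u ∈ S, G.Adj u v := by
  simp [vertexBoundary]

theorem vertexExpansion_le {G : SimpleGraph V} {S : Finset V} (h0 : 0 < S.card)
    (h2 : 2 * S.card ≤ Fintype.card V) :
    vertexExpansion G ≤ ((vertexBoundary G S).card : ℝ) / (S.card : ℝ) := by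
  refine csInf_le ⟨0, ?_⟩ ⟨S, h0, h2, rfl⟩
  rintro r ⟨T, -, -, rfl⟩
  positivity

theorem conductance_le {G : SimpleGraph V} {S : Finset V} (h0 : 0 < vol G S)
    (h2 : 2 * vol G S ≤ vol G Finset.univ) :
    conductance G ≤ (edgeBoundaryCard G S : ℝ) / (vol G S : ℝ) := by
  refine csInf_le ⟨0, ?_⟩ ⟨S, h0, h2, rfl⟩
  rintro r ⟨T, -, -, rfl⟩
  positivity

open Classical in
theorem edgeBoundaryCard_compl (G : SimpleGraph V) (S : Finset V) :
    edgeBoundaryCard G Sᶜ = edgeBoundaryCard G S := by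
  unfold edgeBoundaryCard
  refine Finset.card_bij' (fun e _ => e.swap) (fun e _ => e.swap) ?_ ?_ ?_ ?_
  · rintro ⟨a, b⟩ h
    simp only [SimpleGraph.mem_interedges_iff, Finset.mem_compl, not_not, Prod.swap] at h ⊢
    exact ⟨h.2.1, h.1, h.2.2.symm⟩
  · rintro ⟨a, b⟩ h
    simp only [SimpleGraph.mem_interedges_iff, Finset.mem_compl, not_not, Prod.swap] at h ⊢
    exact ⟨h.2.1, h.1, h.2.2.symm⟩
  · exact fun _ _ => rfl
  · exact fun _ _ => rfl

/-- Charge each crossing edge to its endpoint outside `S`. -/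
theorem edgeBoundaryCard_le (G : SimpleGraph V) (S : Finset V) :
    edgeBoundaryCard G S ≤ ∑ v ∈ vertexBoundary G S, deg G v := by
  classical
  unfold edgeBoundaryCard deg
  rw [← Finset.card_sigma]
  refine Finset.card_le_card_of_injOn (fun e => ⟨e.2, e.1⟩) ?_ ?_
  · rintro ⟨a, b⟩ h
    simp only [Finset.mem_coe, SimpleGraph.mem_interedges_iff, Finset.mem_compl] at h
    simp only [Finset.coe_sigma, Set.mem_sigma_iff, Finset.mem_coe, mem_vertexBoundary,
      Finset.mem_filter, Finset.mem_univ, true_and]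
    exact ⟨⟨h.2.1, a, h.1, h.2.2⟩, h.2.2.symm⟩
  · rintro ⟨a, b⟩ - ⟨c, d⟩ - h
    simp only [Sigma.mk.injEq, heq_eq_eq] at h
    simp [h.1, h.2]

/-- A set that is balanced with respect to cardinality bounds the conductance from above, with no
assumption on its volume. -/
theorem conductance_le_of_balanced {G : SimpleGraph V} {S : Finset V} {b Δ : ℕ}
    (hV : 0 < Fintype.card V) (h4 : Fintype.card V ≤ 4 * S.card) (h2 : 2 * S.card ≤ Fintype.card V)
    (hb : (vertexBoundary G S).card ≤ b) (hpos : ∀ v, 0 < deg G v) (hΔ : ∀ v, deg G v ≤ Δ) :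
    conductance G ≤ 4 * (b * Δ : ℝ) / Fintype.card V := by
  classical
  have he : edgeBoundaryCard G S ≤ b * Δ :=
    calc edgeBoundaryCard G S ≤ ∑ v ∈ vertexBoundary G S, deg G v := edgeBoundaryCard_le G S
      _ ≤ (vertexBoundary G S).card * Δ := by
        simpa using Finset.sum_le_card_nsmul _ _ Δ fun v _ => hΔ v
      _ ≤ b * Δ := Nat.mul_le_mul_right _ hb
  -- Stated for arbitrary `T`: it is applied to whichever of `S` and `Sᶜ` carries at most half the
  -- volume. Degrees are at least 1, so volume dominates cardinality.
  have key : ∀ T : Finset V, Fintype.card V ≤ 4 * T.card → edgeBoundaryCard G T ≤ b * Δ →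
      2 * vol G T ≤ vol G Finset.univ → conductance G ≤ 4 * (b * Δ : ℝ) / Fintype.card V := by
    intro T hT heT hvT
    have hcard : T.card ≤ vol G T := by
      rw [vol_eq_sum_deg]
      simpa using Finset.card_nsmul_le_sum T (deg G) 1 fun v _ => hpos v
    have hT0 : 0 < T.card := by lia
    refine (conductance_le (by lia) hvT).trans ?_
    have h1 : (Fintype.card V : ℝ) ≤ 4 * vol G T := by exact_mod_cast (by lia)
    have h3 : (edgeBoundaryCard G T : ℝ) ≤ b * Δ := by exact_mod_cast heT
    have h0 : (0 : ℝ) < vol G T := by exact_mod_cast (by lia)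
    have hV' : (0 : ℝ) < Fintype.card V := by exact_mod_cast hV
    rw [div_le_div_iff₀ h0 hV']
    calc (edgeBoundaryCard G T : ℝ) * Fintype.card V ≤ (b * Δ) * (4 * vol G T) := by gcongr
      _ = _ := by ring
  have hsum : vol G S + vol G Sᶜ = vol G Finset.univ := by
    simp only [vol_eq_sum_deg]
    exact Finset.sum_add_sum_compl S _
  rcases le_total (2 * vol G S) (vol G Finset.univ) with h | h
  · exact key S h4 he h
  · refine key Sᶜ ?_ (by rwa [edgeBoundaryCard_compl]) (by lia)
    rw [Finset.card_compl]
    lia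

end Expansion

/-! ### Elimination orders and balanced separators -/

section Elimination

variable {m k : ℕ} {G : SimpleGraph (Fin m)}

open Classical in
/-- The neighbors of `v` that precede it. -/
noncomputable def backNeighbors (G : SimpleGraph (Fin m)) (v : Fin m) : Finset (Fin m) :=
  Finset.univ.filter fun u => u < v ∧ G.Adj u v

theorem mem_backNeighbors {u v : Fin m} : u ∈ backNeighbors G v ↔ u < v ∧ G.Adj u v := by
  simp [backNeighbors]

/-- The natural order of the vertices is a connected (reversed) perfect elimination order of
width `k`. -/
structure IsElimination (k : ℕ) (G : SimpleGraph (Fin m)) : Prop where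
  adj : ∀ {u v w : Fin m}, u ∈ backNeighbors G v → w ∈ backNeighbors G v → u ≠ w → G.Adj u w
  card_le : ∀ v, (backNeighbors G v).card ≤ k
  nonempty : ∀ v : Fin m, 0 < v.val → (backNeighbors G v).Nonempty

/-- `x` can be reached from `v` along a path with increasing labels. -/
def Descends (G : SimpleGraph (Fin m)) : Fin m → Fin m → Prop :=
  Relation.ReflTransGen fun a b => a ∈ backNeighbors G b

open Classical in
/-- The vertices that can be reached from `v` along a path with increasing labels. -/
noncomputable def descendants (G : SimpleGraph (Fin m)) (v : Fin m) : Finset (Fin m) :=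
  Finset.univ.filter fun x => Descends G v x

theorem mem_descendants {v x : Fin m} : x ∈ descendants G v ↔ Descends G v x := by
  simp [descendants]

theorem Descends.le {v x : Fin m} (h : Descends G v x) : v ≤ x := by
  induction h with
  | refl => exact le_rfl
  | tail _ h ih => exact ih.trans (mem_backNeighbors.1 h).1.le

/-- Let `z` precede `x` on the path. If `y` is another earlier neighbor of `x`, then `y` and `z` are
adjacent: either `y < z` and induction applies to `z`, or `z < y` and the path to `z` extends to
`y`. -/
theorem IsElimination.backNeighbors_of_descends (hG : IsElimination k G) {v x : Fin m}
    (h : Descends G v x) :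
    ∀ y ∈ backNeighbors G x, Descends G v y ∨ y ∈ backNeighbors G v := by
  induction h with
  | refl => exact fun y hy => Or.inr hy
  | @tail z x hvz hzx ih =>
    intro y hy
    rcases lt_trichotomy y z with hlt | rfl | hlt
    · exact ih y (mem_backNeighbors.2 ⟨hlt, hG.adj hy hzx hlt.ne⟩)
    · exact Or.inl hvz
    · exact Or.inl (hvz.tail (mem_backNeighbors.2 ⟨hlt, hG.adj hzx hy hlt.ne⟩))

theorem IsElimination.vertexBoundary_descendants (hG : IsElimination k G) (v : Fin m) :
    vertexBoundary G (descendants G v) ⊆ backNeighbors G v := by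
  intro y hy
  obtain ⟨hyD, x, hx, hxy⟩ := mem_vertexBoundary.1 hy
  rw [mem_descendants] at hyD hx
  rcases lt_or_gt_of_ne hxy.ne with hlt | hlt
  · exact absurd (hx.tail (mem_backNeighbors.2 ⟨hlt, hxy⟩)) hyD
  · exact (hG.backNeighbors_of_descends hx y (mem_backNeighbors.2 ⟨hlt, hxy.symm⟩)).resolve_left hyD

theorem IsElimination.descends_zero (hG : IsElimination k G) (h0 : 0 < m) (x : Fin m) :
    Descends G ⟨0, h0⟩ x := by
  induction x using WellFoundedLT.induction with
  | ind x ih =>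
    rcases Nat.eq_zero_or_pos x.val with hx | hx
    · have : x = ⟨0, h0⟩ := Fin.ext hx
      rw [this]
      exact Relation.ReflTransGen.refl
    · obtain ⟨y, hy⟩ := hG.nonempty x hx
      exact (ih y (mem_backNeighbors.1 hy).1).tail hy

/-- A balanced set with a small vertex boundary. -/
theorem IsElimination.exists_balanced (hG : IsElimination k G) (hm : 2 ≤ m) :
    ∃ S : Finset (Fin m), m ≤ 4 * S.card ∧ 2 * S.card ≤ m ∧
      (vertexBoundary G S).card ≤ k + 1 := by
  classical
  -- The last vertex with more than half of the graph below it; one exists because vertex 0 reaches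
  -- everything.
  obtain ⟨v, hv, hvmax⟩ : ∃ v, m < 2 * (descendants G v).card ∧
      ∀ x, v < x → 2 * (descendants G x).card ≤ m := by
    have hne : (Finset.univ.filter fun v => m < 2 * (descendants G v).card).Nonempty := by
      refine ⟨⟨0, by lia⟩, ?_⟩
      have : descendants G (⟨0, by lia⟩ : Fin m) = Finset.univ := by
        ext x
        simp [mem_descendants, hG.descends_zero]
      simp only [Finset.mem_filter, Finset.mem_univ, true_and, this, Finset.card_univ,
        Fintype.card_fin]
      lia
    refine ⟨_, (Finset.mem_filter.1 (Finset.max'_mem _ hne)).2, fun x hx => ?_⟩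
    by_contra! h
    exact (Finset.le_max' _ x (by simpa using h)).not_gt hx
  set K := insert v (backNeighbors G v) with hK
  have hKcard : K.card ≤ k + 1 :=
    (Finset.card_insert_le _ _).trans (Nat.add_le_add_right (hG.card_le v) 1)
  set A := (descendants G v).erase v with hA
  have hvA : v ∈ descendants G v := mem_descendants.2 Relation.ReflTransGen.refl
  have hAcard : A.card + 1 = (descendants G v).card := Finset.card_erase_add_one hvA
  have hAK : ∀ x ∈ A, v < x := fun x hx =>
    lt_of_le_of_ne (mem_descendants.1 (Finset.mem_of_mem_erase hx)).le
      (Finset.ne_of_mem_erase hx).symm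
  have hKle : ∀ x ∈ K, x ≤ v := by
    intro x hx
    rcases Finset.mem_insert.1 hx with rfl | hx
    · exact le_rfl
    · exact (mem_backNeighbors.1 hx).1.le
  -- A largest set of proper descendants of `v`, of size at most `m / 2`, separated from the rest by
  -- `K`. If it is smaller than `m / 4`, it can be enlarged or replaced by a single descendant set.
  obtain ⟨S, hS, hSmax⟩ := Finset.exists_max_image
    (A.powerset.filter fun S => 2 * S.card ≤ m ∧ vertexBoundary G S ⊆ K) Finset.card
    ⟨∅, Finset.mem_filter.2 ⟨by simp, by simp, fun y hy => by simp [mem_vertexBoundary] at hy⟩⟩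
  simp only [Finset.mem_filter, Finset.mem_powerset] at hS hSmax
  obtain ⟨hSA, hS2, hSK⟩ := hS
  by_cases hS4 : m ≤ 4 * S.card
  · exact ⟨S, hS4, hS2, (Finset.card_le_card hSK).trans hKcard⟩
  have hne : (A \ S).Nonempty := by
    rw [← Finset.card_pos]
    have := Finset.le_card_sdiff S A
    lia
  obtain ⟨hxA, hxS⟩ := Finset.mem_sdiff.1 (Finset.min'_mem _ hne)
  have hxmin : ∀ y ∈ A \ S, (A \ S).min' hne ≤ y := fun y hy => Finset.min'_le _ y hy
  generalize (A \ S).min' hne = x at hxA hxS hxmin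
  have hvx : Descends G v x := mem_descendants.1 (Finset.mem_of_mem_erase hxA)
  have hxK : x ∉ K := fun h => (hKle x h).not_gt (hAK x hxA)
  -- An earlier neighbor of `x` outside `K` would lie in `A`. In `S` it would put `x` into the
  -- boundary of `S`, hence into `K`, whose labels are at most `v`; outside `S` it would contradict
  -- the minimality of `x`.
  have hBx : backNeighbors G x ⊆ K := by
    intro y hy
    have hyx := mem_backNeighbors.1 hy
    rcases hG.backNeighbors_of_descends hvx y hy with h | h
    · by_cases hyv : y = v
      · exact hyv ▸ Finset.mem_insert_self _ _
      have hyA : y ∈ A := Finset.mem_erase.2 ⟨hyv, mem_descendants.2 h⟩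
      by_cases hyS : y ∈ S
      · exact absurd (hSK (mem_vertexBoundary.2 ⟨hxS, y, hyS, hyx.2⟩)) hxK
      · exact absurd (hxmin y (Finset.mem_sdiff.2 ⟨hyA, hyS⟩)) hyx.1.not_ge
    · exact Finset.mem_insert_of_mem h
  have hDK : vertexBoundary G (descendants G x) ⊆ K :=
    (hG.vertexBoundary_descendants x).trans hBx
  have hD2 := hvmax x (hAK x hxA)
  by_cases hD4 : m ≤ 4 * (descendants G x).card
  · exact ⟨_, hD4, hD2, (Finset.card_le_card hDK).trans hKcard⟩
  -- Both `S` and `descendants G x` are now below `m / 4`, so their union is admissible and strictly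
  -- larger than `S`.
  exfalso
  have hxD : x ∈ descendants G x := mem_descendants.2 Relation.ReflTransGen.refl
  have hle := hSmax (S ∪ descendants G x) ⟨?_, ?_, ?_⟩
  · have : S.card < (S ∪ descendants G x).card :=
      Finset.card_lt_card (Finset.ssubset_iff_subset_ne.2 ⟨Finset.subset_union_left, fun h =>
        hxS (h ▸ Finset.mem_union_right _ hxD)⟩)
    lia
  · refine Finset.union_subset hSA fun y hy => ?_
    have hxy := mem_descendants.1 hy
    exact Finset.mem_erase.2 ⟨((hAK x hxA).trans_le hxy.le).ne',
      mem_descendants.2 (hvx.trans hxy)⟩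
  · have := Finset.card_union_le S (descendants G x)
    lia
  · intro y hy
    obtain ⟨hyn, u, hu, huy⟩ := mem_vertexBoundary.1 hy
    rw [Finset.mem_union, not_or] at hyn
    rcases Finset.mem_union.1 hu with hu | hu
    · exact hSK (mem_vertexBoundary.2 ⟨hyn.1, u, hu, huy⟩)
    · exact hDK (mem_vertexBoundary.2 ⟨hyn.2, u, hu, huy⟩)

end Elimination

/-! ### Effect of one round on the order, degrees and cliques -/

section AddVertex

variable {m k : ℕ} {G : SimpleGraph (Fin m)} {s : Finset (Fin m)}

@[simp]
theorem addVertex_adj_castSucc {a b : Fin m} :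
    (addVertex G s).Adj a.castSucc b.castSucc ↔ G.Adj a b := by
  simp [addVertex, Fin.castSucc_ne_last]

@[simp]
theorem addVertex_adj_last_left {a : Fin m} :
    (addVertex G s).Adj (Fin.last m) a.castSucc ↔ a ∈ s := by
  simp [addVertex, Fin.castSucc_ne_last, (Fin.castSucc_ne_last _).symm]

@[simp]
theorem addVertex_adj_last_right {a : Fin m} :
    (addVertex G s).Adj a.castSucc (Fin.last m) ↔ a ∈ s := by
  rw [SimpleGraph.adj_comm, addVertex_adj_last_left]

theorem backNeighbors_addVertex_castSucc (a : Fin m) :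
    backNeighbors (addVertex G s) a.castSucc = (backNeighbors G a).map Fin.castSuccEmb := by
  ext x
  induction x using Fin.lastCases with
  | last => simp [mem_backNeighbors, Fin.castSucc_ne_last, (Fin.castSucc_lt_last a).not_gt]
  | cast x => simp [mem_backNeighbors]

theorem backNeighbors_addVertex_last :
    backNeighbors (addVertex G s) (Fin.last m) = s.map Fin.castSuccEmb := by
  ext x
  induction x using Fin.lastCases with
  | last => simp [mem_backNeighbors, Fin.castSucc_ne_last]
  | cast x => simp [mem_backNeighbors, Fin.castSucc_lt_last]

theorem IsElimination.addVertex (hG : IsElimination k G) (hs : G.IsNClique k s) (hk : 0 < k) :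
    IsElimination k (addVertex G s) where
  adj := by
    intro u v w hu hw huw
    induction v using Fin.lastCases with
    | last =>
      rw [backNeighbors_addVertex_last, Finset.mem_map] at hu hw
      obtain ⟨a, ha, rfl⟩ := hu
      obtain ⟨b, hb, rfl⟩ := hw
      exact addVertex_adj_castSucc.2 (hs.isClique ha hb fun h => huw (by rw [h]))
    | cast v =>
      rw [backNeighbors_addVertex_castSucc, Finset.mem_map] at hu hw
      obtain ⟨a, ha, rfl⟩ := hu
      obtain ⟨b, hb, rfl⟩ := hw
      exact addVertex_adj_castSucc.2 (hG.adj ha hb fun h => huw (by rw [h]))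
  card_le := by
    intro v
    induction v using Fin.lastCases with
    | last => rw [backNeighbors_addVertex_last, Finset.card_map, hs.card_eq]
    | cast v => rw [backNeighbors_addVertex_castSucc, Finset.card_map]; exact hG.card_le v
  nonempty := by
    intro v hv
    induction v using Fin.lastCases with
    | last =>
      rw [backNeighbors_addVertex_last, Finset.map_nonempty, ← Finset.card_pos, hs.card_eq]
      exact hk
    | cast v =>
      rw [backNeighbors_addVertex_castSucc, Finset.map_nonempty]
      exact hG.nonempty v hv

theorem isElimination_top (k : ℕ) : IsElimination k (⊤ : SimpleGraph (Fin k)) where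
  adj := fun _ _ h => h
  card_le := fun v => (Finset.card_le_univ _).trans (by simp)
  nonempty := fun v hv => ⟨⟨0, by lia⟩, mem_backNeighbors.2
    ⟨Fin.lt_def.2 hv, (Fin.lt_def.2 hv : (⟨0, by lia⟩ : Fin k) < v).ne⟩⟩

theorem deg_addVertex_castSucc (a : Fin m) :
    deg (addVertex G s) a.castSucc = deg G a + if a ∈ s then 1 else 0 := by
  classical
  simp only [deg, Finset.card_filter, Fin.sum_univ_castSucc, addVertex_adj_castSucc,
    addVertex_adj_last_right]

theorem deg_addVertex_last : deg (addVertex G s) (Fin.last m) = s.card := by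
  classical
  simp only [deg, Finset.card_filter, Fin.sum_univ_castSucc, addVertex_adj_last_left,
    SimpleGraph.irrefl, if_false, add_zero]
  simp

theorem deg_top (v : Fin k) : deg (⊤ : SimpleGraph (Fin k)) v = k - 1 := by
  classical
  have : (Finset.univ.filter fun w => (⊤ : SimpleGraph (Fin k)).Adj v w) =
      Finset.univ.erase v := by
    ext w
    simp [eq_comm]
  unfold deg
  convert Finset.card_erase_of_mem (Finset.mem_univ v) using 1
  · exact congrArg Finset.card (by convert this)
  · simp

theorem mem_kCliques {t : Finset (Fin m)} : t ∈ kCliques k G ↔ G.IsNClique k t := by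
  simp [kCliques]

/-- The clique that consists of the new vertex and of all of `s` but `u`. -/
def newClique (s : Finset (Fin m)) (u : Fin m) : Finset (Fin (m + 1)) :=
  insert (Fin.last m) ((s.erase u).map Fin.castSuccEmb)

@[simp]
theorem castSucc_mem_newClique {a u : Fin m} : a.castSucc ∈ newClique s u ↔ a ≠ u ∧ a ∈ s := by
  simp [newClique, Fin.castSucc_ne_last]

theorem last_mem_newClique {u : Fin m} : Fin.last m ∈ newClique s u := by
  simp [newClique]

theorem last_notMem_map {t : Finset (Fin m)} : Fin.last m ∉ t.map Fin.castSuccEmb := by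
  simp [Fin.castSucc_ne_last]

theorem isNClique_newClique (hs : G.IsNClique k s) {u : Fin m} (hu : u ∈ s) :
    (addVertex G s).IsNClique k (newClique s u) := by
  refine ⟨?_, ?_⟩
  · intro x hx y hy hxy
    rw [Finset.mem_coe] at hx hy
    induction x using Fin.lastCases with
    | last =>
      induction y using Fin.lastCases with
      | last => exact absurd rfl hxy
      | cast y => exact addVertex_adj_last_left.2 (castSucc_mem_newClique.1 hy).2
    | cast x =>
      rw [castSucc_mem_newClique] at hx
      induction y using Fin.lastCases with
      | last => exact addVertex_adj_last_right.2 hx.2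
      | cast y =>
        rw [castSucc_mem_newClique] at hy
        exact addVertex_adj_castSucc.2 (hs.isClique hx.2 hy.2 fun h => hxy (by rw [h]))
  · rw [newClique, Finset.card_insert_of_notMem last_notMem_map, Finset.card_map,
      Finset.card_erase_add_one hu, hs.card_eq]

/-- The rest of a clique through the new vertex lies in `s` and has `k - 1` elements, so it misses
exactly one `u ∈ s`. -/
theorem isNClique_addVertex_cases (hs : G.IsNClique k s) {t : Finset (Fin (m + 1))}
    (ht : (addVertex G s).IsNClique k t) :
    (∃ t', G.IsNClique k t' ∧ t'.map Fin.castSuccEmb = t) ∨ ∃ u ∈ s, newClique s u = t := by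
  classical
  set t' := Finset.univ.filter fun a : Fin m => a.castSucc ∈ t with ht'
  have hmem : ∀ a, a ∈ t' ↔ a.castSucc ∈ t := by simp [ht']
  by_cases hl : Fin.last m ∈ t
  · right
    have hsub : t' ⊆ s := fun a ha => addVertex_adj_last_right.1
      (ht.isClique ((hmem a).1 ha) hl (Fin.castSucc_ne_last a))
    have htt : insert (Fin.last m) (t'.map Fin.castSuccEmb) = t := by
      ext x
      induction x using Fin.lastCases with
      | last => simp [hl]
      | cast x => simp [hmem, Fin.castSucc_ne_last]
    have hcard : t'.card + 1 = s.card := by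
      rw [hs.card_eq, ← ht.card_eq, ← htt, Finset.card_insert_of_notMem last_notMem_map,
        Finset.card_map]
    obtain ⟨u, hu⟩ := Finset.card_eq_one.1
      (show (s \ t').card = 1 by rw [Finset.card_sdiff_of_subset hsub]; lia)
    have hus : u ∈ s := (Finset.mem_sdiff.1 (hu ▸ Finset.mem_singleton_self u)).1
    refine ⟨u, hus, ?_⟩
    rw [newClique, ← htt, Finset.erase_eq, ← hu, Finset.sdiff_sdiff_eq_self hsub]
  · left
    have htt : t'.map Fin.castSuccEmb = t := by
      ext x
      induction x using Fin.lastCases with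
      | last => simp [hl, Fin.castSucc_ne_last]
      | cast x => simp [hmem]
    refine ⟨t', ⟨fun a ha b hb hab => ?_, by rw [← ht.card_eq, ← htt, Finset.card_map]⟩, htt⟩
    exact addVertex_adj_castSucc.1 (ht.isClique ((hmem a).1 ha) ((hmem b).1 hb)
      fun h => hab (Fin.castSucc_injective m h))

theorem kCliques_addVertex (hs : G.IsNClique k s) :
    kCliques k (addVertex G s) =
      (kCliques k G).image (Finset.map Fin.castSuccEmb) ∪ s.image (newClique s) := by
  ext t
  simp only [Finset.mem_union, Finset.mem_image, mem_kCliques]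
  constructor
  · exact isNClique_addVertex_cases hs
  · rintro (⟨t', ht', rfl⟩ | ⟨u, hu, rfl⟩)
    · exact isNClique_addVertex s ht'
    · exact isNClique_newClique hs hu

theorem newClique_injOn : Set.InjOn (newClique s) s := by
  intro u hu v hv h
  by_contra huv
  have : u.castSucc ∈ newClique s v := castSucc_mem_newClique.2 ⟨huv, hu⟩
  rw [← h, castSucc_mem_newClique] at this
  exact this.1 rfl

theorem card_kCliques_addVertex (hs : G.IsNClique k s) :
    (kCliques k (addVertex G s)).card = (kCliques k G).card + k := by
  rw [kCliques_addVertex hs, Finset.card_union_of_disjoint,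
    Finset.card_image_of_injective _ (Finset.map_injective _),
    Finset.card_image_of_injOn newClique_injOn, hs.card_eq]
  rw [Finset.disjoint_left]
  intro t ht ht'
  obtain ⟨a, -, rfl⟩ := Finset.mem_image.1 ht
  obtain ⟨u, -, h⟩ := Finset.mem_image.1 ht'
  exact last_notMem_map (h ▸ last_mem_newClique : Fin.last m ∈ a.map Fin.castSuccEmb)

/-- The `k`-cliques through `v`. -/
noncomputable def kCliquesAt (k : ℕ) (G : SimpleGraph (Fin m)) (v : Fin m) :
    Finset (Finset (Fin m)) :=
  (kCliques k G).filter fun t => v ∈ t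

/-- When `v ∈ s`, the new cliques through `v` are those that omit some other vertex of `s`. Thus one
unit of degree costs at most `k - 1` cliques. -/
theorem card_kCliquesAt_castSucc_le (hs : G.IsNClique k s) (v : Fin m) :
    (kCliquesAt k (addVertex G s) v.castSucc).card ≤
      (kCliquesAt k G v).card + if v ∈ s then k - 1 else 0 := by
  have hsub : kCliquesAt k (addVertex G s) v.castSucc ⊆
      (kCliquesAt k G v).image (Finset.map Fin.castSuccEmb) ∪
        (if v ∈ s then s.erase v else ∅).image (newClique s) := by
    intro t ht
    obtain ⟨ht, hv⟩ := Finset.mem_filter.1 ht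
    rw [kCliques_addVertex hs] at ht
    rcases Finset.mem_union.1 ht with h | h
    · obtain ⟨a, ha, rfl⟩ := Finset.mem_image.1 h
      exact Finset.mem_union_left _ (Finset.mem_image_of_mem _
        (Finset.mem_filter.2 ⟨ha, by simpa using hv⟩))
    · obtain ⟨u, hu, rfl⟩ := Finset.mem_image.1 h
      obtain ⟨hvu, hvs⟩ := castSucc_mem_newClique.1 hv
      refine Finset.mem_union_right _ (Finset.mem_image_of_mem _ ?_)
      simp [hvs, hu, hvu.symm]
  refine (Finset.card_le_card hsub).trans ((Finset.card_union_le _ _).trans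
    (add_le_add Finset.card_image_le (Finset.card_image_le.trans ?_)))
  split_ifs with h
  · rw [Finset.card_erase_of_mem h, hs.card_eq]
  · simp

theorem card_kCliquesAt_last_le (hs : G.IsNClique k s) :
    (kCliquesAt k (addVertex G s) (Fin.last m)).card ≤ k := by
  have hsub : kCliquesAt k (addVertex G s) (Fin.last m) ⊆ s.image (newClique s) := by
    intro t ht
    obtain ⟨ht, hv⟩ := Finset.mem_filter.1 ht
    rw [kCliques_addVertex hs] at ht
    rcases Finset.mem_union.1 ht with h | h
    · obtain ⟨a, ha, rfl⟩ := Finset.mem_image.1 h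
      exact absurd hv last_notMem_map
    · exact h
  exact (Finset.card_le_card hsub).trans (Finset.card_image_le.trans hs.card_eq.le)

end AddVertex

/-- The graphs that are possible outcomes of `n` rounds. -/
inductive IsKTree (k : ℕ) : (n : ℕ) → SimpleGraph (Fin (k + n)) → Prop
  | base : IsKTree k 0 ⊤
  | step {n : ℕ} {G : SimpleGraph (Fin (k + n))} {s : Finset (Fin (k + n))} :
      IsKTree k n G → G.IsNClique k s → IsKTree k (n + 1) (addVertex G s)

/-! ### Invariants of all outcomes -/

section KTree

variable {k n : ℕ} {G : SimpleGraph (Fin (k + n))}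

theorem IsKTree.isElimination (h : IsKTree k n G) (hk : 0 < k) : IsElimination k G := by
  induction h with
  | base => exact isElimination_top k
  | step _ hs ih => exact ih.addVertex hs hk

theorem IsKTree.deg_pos (h : IsKTree k n G) (hk : 2 ≤ k) : ∀ v, 0 < deg G v := by
  induction h with
  | base =>
    intro v
    have := deg_top (k := k) v
    simp only [Nat.add_zero] at *
    lia
  | step _ hs ih =>
    intro v
    induction v using Fin.lastCases with
    | last => rw [deg_addVertex_last, hs.card_eq]; lia
    | cast v => rw [deg_addVertex_castSucc]; exact Nat.add_pos_left (ih v) _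

theorem kCliques_top : kCliques k (⊤ : SimpleGraph (Fin k)) = {Finset.univ} := by
  ext t
  rw [mem_kCliques, Finset.mem_singleton, ← Finset.card_eq_iff_eq_univ, Fintype.card_fin]
  exact ⟨fun h => h.card_eq, fun h => ⟨fun a _ b _ hab => hab, h⟩⟩

/-- Each round creates exactly `k` cliques, so the denominator of the uniform choice does not depend
on the history. -/
theorem IsKTree.card_kCliques (h : IsKTree k n G) : (kCliques k G).card = k * n + 1 := by
  induction h with
  | base => exact (congrArg Finset.card kCliques_top).trans (by simp)
  | step _ hs ih => rw [card_kCliques_addVertex hs, ih]; ring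

/-- Each new edge at `v` brings at most `k - 1` cliques; a newborn vertex starts with at most `k ≤
(k - 1) * k` and an initial one with `1 ≤ (k - 1) * (k - 1)`, both by `2 ≤ k`. -/
theorem IsKTree.card_kCliquesAt_le (h : IsKTree k n G) (hk : 2 ≤ k) :
    ∀ v, (kCliquesAt k G v).card ≤ (k - 1) * deg G v := by
  induction h with
  | base =>
    intro v
    have h1 : (kCliquesAt k (⊤ : SimpleGraph (Fin (k + 0))) v).card ≤ 1 := by
      refine (Finset.card_le_card (Finset.filter_subset _ _)).trans ?_
      exact (congrArg Finset.card kCliques_top).le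
    have h2 : deg (⊤ : SimpleGraph (Fin (k + 0))) v = k - 1 := deg_top (k := k) v
    rw [h2]
    have : 1 ≤ k - 1 := by lia
    nlinarith
  | step _ hs ih =>
    intro v
    induction v using Fin.lastCases with
    | last =>
      rw [deg_addVertex_last, hs.card_eq]
      exact (card_kCliquesAt_last_le hs).trans (Nat.le_mul_of_pos_left _ (by lia))
    | cast v =>
      rw [deg_addVertex_castSucc]
      refine (card_kCliquesAt_castSucc_le hs v).trans ?_
      split_ifs
      · rw [mul_add_one]
        exact Nat.add_le_add_right (ih v) _
      · exact ih v

end KTree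

/-! ### Expectations and Markov's inequality for `PMF` -/

section Expectation

open scoped ENNReal

variable {α β : Type*}

/-- The expectation of `F` under `p`. -/
noncomputable def expect (p : PMF α) (F : α → ℝ≥0∞) : ℝ≥0∞ := ∑' a, p a * F a

theorem expect_pure (a : α) (F : α → ℝ≥0∞) : expect (PMF.pure a) F = F a := by
  unfold expect
  rw [tsum_eq_single a]
  · simp
  · intro b hb
    simp [hb]

theorem expect_bind (p : PMF α) (q : α → PMF β) (F : β → ℝ≥0∞) :
    expect (p.bind q) F = expect p fun a => expect (q a) F := by
  simp only [expect, PMF.bind_apply, ← ENNReal.tsum_mul_right, ← ENNReal.tsum_mul_left]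
  rw [ENNReal.tsum_comm]
  simp only [mul_assoc]

theorem expect_map (p : PMF α) (g : α → β) (F : β → ℝ≥0∞) :
    expect (p.map g) F = expect p (F ∘ g) := by
  rw [← PMF.bind_pure_comp, expect_bind]
  simp only [Function.comp_def, expect_pure]

theorem expect_uniformOfFinset (S : Finset α) (hS : S.Nonempty) (F : α → ℝ≥0∞) :
    expect (PMF.uniformOfFinset S hS) F = (∑ s ∈ S, F s) / S.card := by
  unfold expect
  rw [tsum_eq_sum (s := S), ENNReal.div_eq_inv_mul, Finset.mul_sum]
  · exact Finset.sum_congr rfl fun s hs => by rw [PMF.uniformOfFinset_apply_of_mem hS hs]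
  · intro s hs
    rw [PMF.uniformOfFinset_apply_of_notMem hS hs, zero_mul]

theorem expect_mono_of_support {p : PMF α} {F H : α → ℝ≥0∞} (h : ∀ a ∈ p.support, F a ≤ H a) :
    expect p F ≤ expect p H := by
  refine ENNReal.tsum_le_tsum fun a => ?_
  by_cases ha : p a = 0
  · simp [ha]
  · exact mul_le_mul_right (h a ((PMF.mem_support_iff _ _).2 ha)) _

theorem expect_mul_add (p : PMF α) (F : α → ℝ≥0∞) (x c : ℝ≥0∞) :
    expect p (fun a => x * F a + c) = x * expect p F + c := by
  simp only [expect, mul_add]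
  rw [ENNReal.tsum_add, ENNReal.tsum_mul_right, p.tsum_coe, one_mul, ← ENNReal.tsum_mul_left]
  congr 1
  exact tsum_congr fun a => by ring

/-- Markov's inequality. -/
theorem toOuterMeasure_le_expect_div (p : PMF α) (F : α → ℝ≥0∞) {x : ℝ≥0∞} (h0 : x ≠ 0)
    (hx : x ≠ ∞) : p.toOuterMeasure {a | x ≤ F a} ≤ expect p F / x := by
  rw [ENNReal.le_div_iff_mul_le (Or.inl h0) (Or.inl hx), PMF.toOuterMeasure_apply,
    ← ENNReal.tsum_mul_right]
  refine ENNReal.tsum_le_tsum fun a => ?_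
  by_cases ha : x ≤ F a
  · rw [Set.indicator_of_mem (by exact ha)]
    gcongr
  · rw [Set.indicator_of_notMem (by exact ha), zero_mul]
    exact zero_le

theorem one_sub_le_toOuterMeasure (p : PMF α) {s t : Set α} (h : ∀ a ∈ p.support, a ∉ t → a ∈ s) :
    1 - p.toOuterMeasure t ≤ p.toOuterMeasure s := by
  rw [tsub_le_iff_right, ← p.tsum_coe, PMF.toOuterMeasure_apply, PMF.toOuterMeasure_apply,
    ← ENNReal.tsum_add]
  refine ENNReal.tsum_le_tsum fun a => ?_
  by_cases ha : p a = 0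
  · simp [ha]
  by_cases hat : a ∈ t
  · rw [Set.indicator_of_mem hat]
    exact le_add_self
  · rw [Set.indicator_of_mem (h a ((PMF.mem_support_iff _ _).2 ha) hat)]
    exact le_self_add

theorem toOuterMeasure_le_one (p : PMF α) (s : Set α) : p.toOuterMeasure s ≤ 1 := by
  rw [PMF.toOuterMeasure_apply, ← p.tsum_coe]
  exact ENNReal.tsum_le_tsum fun a => Set.indicator_le_self _ _ _

end Expectation

/-! ### Third moment of the degrees -/

section Energy

variable {m k : ℕ} {G : SimpleGraph (Fin m)} {s : Finset (Fin m)}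

/-- The sum of the third rising factorials of the degrees. -/
noncomputable def energy (G : SimpleGraph (Fin m)) : ℕ :=
  ∑ v, (deg G v).ascFactorial 3

theorem ascFactorial_three (d : ℕ) : d.ascFactorial 3 = d * (d + 1) * (d + 2) := by
  simp only [Nat.ascFactorial]
  ring

theorem deg_pow_three_le_energy (v : Fin m) : deg G v ^ 3 ≤ energy G :=
  calc deg G v ^ 3 ≤ (deg G v).ascFactorial 3 := by
        rw [ascFactorial_three, pow_three]
        nlinarith
    _ ≤ energy G :=
      Finset.single_le_sum (f := fun v => (deg G v).ascFactorial 3) (fun _ _ => Nat.zero_le _)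
        (Finset.mem_univ v)

theorem energy_addVertex (hs : s.card = k) :
    energy (addVertex G s) = energy G +
      (∑ v, if v ∈ s then 3 * ((deg G v + 1) * (deg G v + 2)) else 0) + k.ascFactorial 3 := by
  unfold energy
  rw [Fin.sum_univ_castSucc, deg_addVertex_last, hs, ← Finset.sum_add_distrib]
  congr 1
  refine Finset.sum_congr rfl fun v _ => ?_
  rw [deg_addVertex_castSucc]
  split_ifs
  · simp only [ascFactorial_three]
    ring
  · rfl

/-- Raising `d` by one raises the rising factorial by `3 * (d + 1) * (d + 2)`, and weighting this by
`d` gives back three times the factorial itself. The clique bound supplies the weight `(k - 1) * d`,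
so the estimate closes up linearly in the energy. -/
theorem sum_energy_addVertex_le
    (hG : ∀ v, (kCliquesAt k G v).card ≤ (k - 1) * deg G v) :
    ∑ s ∈ kCliques k G, energy (addVertex G s) ≤
      (kCliques k G).card * (energy G + k.ascFactorial 3) + 3 * (k - 1) * energy G := by
  have h1 : ∑ s ∈ kCliques k G, energy (addVertex G s) =
      (kCliques k G).card * (energy G + k.ascFactorial 3) +
        ∑ v, (kCliquesAt k G v).card * (3 * ((deg G v + 1) * (deg G v + 2))) := by
    rw [Finset.sum_congr rfl fun s hs => energy_addVertex (mem_kCliques.1 hs).card_eq,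
      Finset.sum_add_distrib, Finset.sum_add_distrib, Finset.sum_comm]
    simp only [← Finset.sum_filter, Finset.sum_const, smul_eq_mul]
    unfold kCliquesAt
    ring
  rw [h1, energy, Finset.mul_sum]
  refine Nat.add_le_add_left (Finset.sum_le_sum fun v _ => ?_) _
  rw [ascFactorial_three]
  calc _ ≤ ((k - 1) * deg G v) * (3 * ((deg G v + 1) * (deg G v + 2))) :=
        Nat.mul_le_mul_right _ (hG v)
    _ = _ := by ring

end Energy

/-! ### Growth of the expected energy -/

section Law

open scoped ENNReal

variable {k : ℕ}

theorem isKTree_of_mem_support {n : ℕ} :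
    ∀ G ∈ (processLaw k n).support, IsKTree k n G.1 := by
  induction n with
  | zero =>
    intro G hG
    rw [processLaw, PMF.mem_support_pure_iff] at hG
    subst hG
    exact IsKTree.base
  | succ n ih =>
    intro G hG
    rw [processLaw, PMF.mem_support_bind_iff] at hG
    obtain ⟨H, hH, hG⟩ := hG
    rw [step, PMF.mem_support_map_iff] at hG
    obtain ⟨s, hs, rfl⟩ := hG
    rw [PMF.mem_support_uniformOfFinset_iff] at hs
    exact (ih H hH).step (mem_kCliques.1 hs)

/-- The expected energy after `n` rounds. -/
noncomputable def meanEnergy (k n : ℕ) : ℝ≥0∞ :=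
  expect (processLaw k n) fun G => (energy G.1 : ℝ≥0∞)

theorem expect_step_energy_le {n : ℕ} {G : CliqueGraph k (k + n)} (hG : IsKTree k n G.1)
    (hk : 2 ≤ k) :
    expect (step G) (fun H => (energy H.1 : ℝ≥0∞)) ≤
      (1 + ((3 * (k - 1) : ℕ) : ℝ≥0∞) / ((k * n + 1 : ℕ) : ℝ≥0∞)) * (energy G.1 : ℝ≥0∞) +
        (k.ascFactorial 3 : ℝ≥0∞) := by
  rw [step, expect_map, expect_uniformOfFinset, hG.card_kCliques]
  have h := sum_energy_addVertex_le (hG.card_kCliquesAt_le hk)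
  rw [hG.card_kCliques] at h
  have h' : ∑ s ∈ kCliques k G.1, (energy (addVertex G.1 s) : ℝ≥0∞) ≤
      ((k * n + 1 : ℕ) : ℝ≥0∞) * (energy G.1 + k.ascFactorial 3 : ℕ) +
        ((3 * (k - 1) : ℕ) : ℝ≥0∞) * (energy G.1 : ℝ≥0∞) := by
    exact_mod_cast h
  have hN0 : ((k * n + 1 : ℕ) : ℝ≥0∞) ≠ 0 := by simp
  have hNt : ((k * n + 1 : ℕ) : ℝ≥0∞) ≠ ∞ := ENNReal.natCast_ne_top _
  generalize ((k * n + 1 : ℕ) : ℝ≥0∞) = N at *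
  refine (ENNReal.div_le_div_right h' N).trans (le_of_eq ?_)
  rw [ENNReal.add_div, mul_comm N, ENNReal.mul_div_cancel_right hN0 hNt]
  simp only [div_eq_mul_inv]
  push_cast
  ring

theorem meanEnergy_succ_le (hk : 2 ≤ k) (n : ℕ) :
    meanEnergy k (n + 1) ≤
      (1 + ((3 * (k - 1) : ℕ) : ℝ≥0∞) / ((k * n + 1 : ℕ) : ℝ≥0∞)) * meanEnergy k n +
        (k.ascFactorial 3 : ℝ≥0∞) := by
  unfold meanEnergy
  rw [← expect_mul_add]
  exact (expect_bind _ _ _).trans_le (expect_mono_of_support fun G hG =>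
    expect_step_energy_le (isKTree_of_mem_support G hG) hk)

theorem meanEnergy_ne_top (hk : 2 ≤ k) (n : ℕ) : meanEnergy k n ≠ ∞ := by
  induction n with
  | zero =>
    unfold meanEnergy processLaw
    rw [expect_pure]
    exact ENNReal.natCast_ne_top _
  | succ n ih =>
    refine ne_top_of_le_ne_top ?_ (meanEnergy_succ_le hk n)
    refine ENNReal.add_ne_top.2 ⟨ENNReal.mul_ne_top (ENNReal.add_ne_top.2 ⟨by simp, ?_⟩) ih,
      ENNReal.natCast_ne_top _⟩
    exact ENNReal.div_ne_top (ENNReal.natCast_ne_top _) (by simp)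

/-- Since `β` exceeds 1, the additive constant does not affect the order of growth. -/
theorem le_mul_rpow_of_recurrence {e : ℕ → ℝ} {β c : ℝ} (hβ : 3 / 2 ≤ β) (hc : 0 ≤ c)
    (h : ∀ n : ℕ, 1 ≤ n → e (n + 1) ≤ (1 + β / n) * e n + c) :
    ∀ n : ℕ, 1 ≤ n → e n ≤ (|e 1| + 2 * c) * (n : ℝ) ^ β := by
  -- The subtracted linear term absorbs `c`: the induction closes when `c - 2 * c * β ≤ -2 * c`,
  -- which is where `3 / 2 ≤ β` enters.
  have key : ∀ n : ℕ, 1 ≤ n → e n ≤ (|e 1| + 2 * c) * (n : ℝ) ^ β - 2 * c * n := by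
    intro n hn
    induction n, hn using Nat.le_induction with
    | base =>
      have := le_abs_self (e 1)
      simp only [Nat.cast_one, Real.one_rpow]
      linarith
    | succ n hn ih =>
      have hn0 : (0 : ℝ) < n := by exact_mod_cast hn
      -- Bernoulli's inequality for `(1 + 1 / n) ^ β`.
      have hbern : (n : ℝ) ^ β * (1 + β / n) ≤ ((n + 1 : ℕ) : ℝ) ^ β := by
        have h1 : ((n + 1 : ℕ) : ℝ) = n * (1 + 1 / n) := by
          push_cast
          field_simp
        rw [h1, Real.mul_rpow hn0.le (by positivity)]
        have h2 := one_add_mul_self_le_rpow_one_add (s := 1 / (n : ℝ)) (p := β)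
          (by linarith [show (0 : ℝ) ≤ 1 / n by positivity]) (by linarith)
        refine mul_le_mul_of_nonneg_left ?_ (by positivity)
        calc 1 + β / n = 1 + β * (1 / n) := by ring
          _ ≤ _ := h2
      have hA : 0 ≤ |e 1| + 2 * c := by positivity
      calc e (n + 1) ≤ (1 + β / n) * e n + c := h n hn
        _ ≤ (1 + β / n) * ((|e 1| + 2 * c) * (n : ℝ) ^ β - 2 * c * n) + c := by gcongr
        _ = (|e 1| + 2 * c) * ((n : ℝ) ^ β * (1 + β / n)) - 2 * c * n - 2 * c * β + c := by
          field_simp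
          ring
        _ ≤ (|e 1| + 2 * c) * ((n + 1 : ℕ) : ℝ) ^ β - 2 * c * n - 2 * c * β + c := by gcongr
        _ ≤ _ := by
          push_cast
          nlinarith
  intro n hn
  have : 0 ≤ 2 * c * (n : ℝ) := by positivity
  linarith [key n hn]

theorem exists_meanEnergy_le (hk : 2 ≤ k) :
    ∃ A : ℝ, 0 ≤ A ∧ ∀ n : ℕ, 1 ≤ n →
      meanEnergy k n ≤ ENNReal.ofReal (A * (n : ℝ) ^ (3 * (1 - 1 / (k : ℝ)))) := by
  have hk' : (2 : ℝ) ≤ k := by exact_mod_cast hk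
  -- The third moment is high enough to reach the threshold `3 / 2` already at `k = 2`.
  have hβ : 3 / 2 ≤ 3 * (1 - 1 / (k : ℝ)) := by
    have : 1 / (k : ℝ) ≤ 1 / 2 := one_div_le_one_div_of_le (by norm_num) hk'
    linarith
  refine ⟨_, ?_, fun n hn => (ENNReal.le_ofReal_iff_toReal_le (meanEnergy_ne_top hk n) ?_).2
    (le_mul_rpow_of_recurrence (e := fun n => (meanEnergy k n).toReal)
      (c := (k.ascFactorial 3 : ℝ)) hβ (by positivity) ?_ n hn)⟩
  · positivity
  · positivity
  intro n hn
  have hn0 : (0 : ℝ) < n := by exact_mod_cast hn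
  have hfin : ((3 * (k - 1) : ℕ) : ℝ≥0∞) / ((k * n + 1 : ℕ) : ℝ≥0∞) ≠ ∞ :=
    ENNReal.div_ne_top (ENNReal.natCast_ne_top _) (by simp)
  have hfin' := ENNReal.add_ne_top.2 ⟨ENNReal.one_ne_top, hfin⟩
  have h := ENNReal.toReal_mono (ENNReal.add_ne_top.2 ⟨ENNReal.mul_ne_top hfin'
    (meanEnergy_ne_top hk n), ENNReal.natCast_ne_top _⟩) (meanEnergy_succ_le hk n)
  rw [ENNReal.toReal_add (ENNReal.mul_ne_top hfin' (meanEnergy_ne_top hk n))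
    (ENNReal.natCast_ne_top _), ENNReal.toReal_mul, ENNReal.toReal_add ENNReal.one_ne_top hfin,
    ENNReal.toReal_div, ENNReal.toReal_natCast, ENNReal.toReal_natCast, ENNReal.toReal_natCast,
    ENNReal.toReal_one] at h
  refine h.trans ?_
  have hle : ((3 * (k - 1) : ℕ) : ℝ) / ((k * n + 1 : ℕ) : ℝ) ≤ 3 * (1 - 1 / (k : ℝ)) / n := by
    rw [Nat.cast_mul, Nat.cast_sub (by lia)]
    push_cast
    calc 3 * ((k : ℝ) - 1) / (k * n + 1) ≤ 3 * ((k : ℝ) - 1) / (k * n) := by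
          gcongr
          · linarith
          · linarith
      _ = _ := by field_simp
  gcongr

end Law

/-! ### The two bounds -/

section Main

open scoped ENNReal

variable {k : ℕ}

theorem vertexExpansion_le_of_isKTree {n : ℕ} {G : SimpleGraph (Fin (k + n))}
    (hG : IsKTree k n G) (hk : 2 ≤ k) (hn : 1 ≤ n) :
    vertexExpansion G ≤ 8 * ((k : ℝ) / n) := by
  obtain ⟨S, h4, h2, hb⟩ := (hG.isElimination (by lia)).exists_balanced (by lia)
  have hS : 0 < S.card := by lia
  refine (vertexExpansion_le hS (by simpa using h2)).trans ?_
  have hS' : (0 : ℝ) < S.card := by exact_mod_cast hS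
  have hn' : (0 : ℝ) < n := by exact_mod_cast hn
  -- Here `k + 1 ≤ 2 * k`; with `n ≤ 4 * S.card` this yields the constant 8.
  have h1 : ((vertexBoundary G S).card : ℝ) ≤ 2 * k := by exact_mod_cast (by lia)
  have h3 : (n : ℝ) ≤ 4 * S.card := by exact_mod_cast (by lia)
  rw [← mul_div_assoc, div_le_div_iff₀ hS' hn']
  calc ((vertexBoundary G S).card : ℝ) * n ≤ (2 * k) * (4 * S.card) := by gcongr
    _ = _ := by ring

theorem conductance_le_of_energy_lt {n : ℕ} {G : SimpleGraph (Fin (k + n))}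
    (hG : IsKTree k n G) (hk : 2 ≤ k) (hn : 1 ≤ n) {x : ℝ} (hx : 0 ≤ x)
    (hE : (energy G : ℝ) < x ^ 3) :
    conductance G ≤ 4 * ((k + 1) * x) / n := by
  obtain ⟨S, h4, h2, hb⟩ := (hG.isElimination (by lia)).exists_balanced (by lia)
  -- A single degree cubed is at most the energy; the floor provides the integer degree bound.
  have hdeg : ∀ v, deg G v ≤ ⌊x⌋₊ := by
    intro v
    refine Nat.le_floor (le_of_lt (lt_of_pow_lt_pow_left₀ 3 hx (lt_of_le_of_lt ?_ hE)))
    exact_mod_cast deg_pow_three_le_energy v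
  have h := conductance_le_of_balanced (G := G) (S := S) (by simp; lia) (by simpa using h4)
    (by simpa using h2) hb (hG.deg_pos hk) hdeg
  refine h.trans ?_
  have hn' : (0 : ℝ) < n := by exact_mod_cast hn
  have hfl := Nat.floor_le hx
  rw [Fintype.card_fin]
  push_cast
  gcongr
  linarith [(Nat.cast_nonneg k : (0 : ℝ) ≤ k)]

theorem tendsto_conductance (hk : 2 ≤ k) :
    Tendsto (fun n : ℕ => (randomKTree k n).toOuterMeasure
      {G | conductance G ≤ 8 * (Real.log (n : ℝ) * (n : ℝ) ^ (-(1 / (k : ℝ))))}) atTop (𝓝 1) := by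
  obtain ⟨A, hA, hmean⟩ := exists_meanEnergy_le hk
  have hlim : Tendsto (fun n : ℕ => 1 -
      ENNReal.ofReal (A * ((k : ℝ) + 1) ^ 3 / Real.log (n : ℝ) ^ 3)) atTop (𝓝 1) := by
    have h1 : Tendsto (fun n : ℕ => A * ((k : ℝ) + 1) ^ 3 / Real.log (n : ℝ) ^ 3) atTop (𝓝 0) :=
      Tendsto.div_atTop tendsto_const_nhds ((tendsto_pow_atTop (by norm_num)).comp
        (Real.tendsto_log_atTop.comp tendsto_natCast_atTop_atTop))
    have h2 := ENNReal.Tendsto.sub (tendsto_const_nhds (x := (1 : ℝ≥0∞)))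
      (ENNReal.tendsto_ofReal h1) (Or.inl ENNReal.one_ne_top)
    simpa using h2
  refine tendsto_of_tendsto_of_tendsto_of_le_of_le' hlim tendsto_const_nhds ?_
    (Eventually.of_forall fun n => toOuterMeasure_le_one _ _)
  filter_upwards [eventually_ge_atTop 2] with n hn
  have hn1 : (1 : ℝ) < n := by exact_mod_cast (by lia)
  have hn0 : (0 : ℝ) < n := by linarith
  have hlog : 0 < Real.log n := Real.log_pos hn1
  -- With this threshold `4 * (k + 1) * x / n` is `4 * log n * n ^ (-1 / k)`, and Markov's
  -- inequality bounds the failure probability by `A * (k + 1) ^ 3 / log n ^ 3`, which tends to 0.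
  set x : ℝ := Real.log n * (n : ℝ) ^ (1 - 1 / (k : ℝ)) / (k + 1) with hx
  have hx0 : 0 < x := by positivity
  rw [randomKTree, PMF.toOuterMeasure_map_apply]
  refine le_trans ?_ (one_sub_le_toOuterMeasure (processLaw k n)
    (t := {G | ENNReal.ofReal (x ^ 3) ≤ (energy G.1 : ℝ≥0∞)}) ?_)
  · refine tsub_le_tsub_left ((toOuterMeasure_le_expect_div _ _ ?_ ENNReal.ofReal_ne_top).trans
      ((ENNReal.div_le_div_right (hmean n (by lia)) _).trans_eq ?_)) 1
    · simpa using pow_pos hx0 3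
    · rw [← ENNReal.ofReal_div_of_pos (by positivity)]
      congr 1
      have h3 : (n : ℝ) ^ (3 * (1 - 1 / (k : ℝ))) = ((n : ℝ) ^ (1 - 1 / (k : ℝ))) ^ 3 := by
        rw [mul_comm, Real.rpow_mul hn0.le]
        norm_cast
      rw [h3, hx]
      field_simp
  · intro G hG hE
    rw [Set.mem_ofPred_eq, not_le, ← ENNReal.ofReal_natCast,
      ENNReal.ofReal_lt_ofReal_iff (by positivity)] at hE
    refine (conductance_le_of_energy_lt (isKTree_of_mem_support G hG) hk (by lia) hx0.le hE).trans
      ?_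
    have h4 : (n : ℝ) ^ (1 - 1 / (k : ℝ)) = n * (n : ℝ) ^ (-(1 / (k : ℝ))) := by
      rw [sub_eq_add_neg, Real.rpow_add hn0, Real.rpow_one]
    have h5 : 4 * (((k : ℝ) + 1) * x) / n =
        4 * (Real.log n * (n : ℝ) ^ (-(1 / (k : ℝ)))) := by
      rw [hx, h4]
      field_simp
    rw [h5]
    have : 0 ≤ Real.log n * (n : ℝ) ^ (-(1 / (k : ℝ))) := by positivity
    linarith

end Main

end RandomKTree

theorem mainTheorem4 :
    ∃ C : ℝ, 0 < C ∧ ∀ k : ℕ, 2 ≤ k →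
      (∀ n : ℕ, 1 ≤ n → ∀ G ∈ (RandomKTree.randomKTree k n).support,
        RandomKTree.vertexExpansion G ≤ C * ((k : ℝ) / (n : ℝ))) ∧
      Tendsto (fun n : ℕ => (RandomKTree.randomKTree k n).toOuterMeasure
          {G | RandomKTree.conductance G ≤
            C * (Real.log (n : ℝ) * (n : ℝ) ^ (-(1 / (k : ℝ))))})
        atTop (𝓝 1) := by
  refine ⟨8, by norm_num, fun k hk => ⟨fun n hn G hG => ?_, RandomKTree.tendsto_conductance hk⟩⟩
  obtain ⟨H, hH, rfl⟩ := (PMF.mem_support_map_iff _ _ _).1 hG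
  exact RandomKTree.vertexExpansion_le_of_isKTree (RandomKTree.isKTree_of_mem_support H hH) hk hn
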